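/- Let $n\ge 1$, $\Delta^n=\{\mu\in\mathbb R^n:\mu_i\ge 0,\ \sum_i\mu_i=1\}$ and $\delta\in[0,1]$. Let $\phi:[0,\infty)\to(-\infty,+\infty]$ be convex with $\phi(1)=0$ and lower semicontinuous at $1$ (automatic if $\phi$ is finite near $1$). For $\alpha\in\mathbb R$ let $$\mathcal A_\alpha=\Big\{\mu\in\Delta^n:\ I_\phi(\mu,\mathbf 1_n/n)=\tfrac1n\sum_{i=1}^n\phi(n\mu_i)\le\alpha\Big\}.$$ *Calibration.* A random variable $Z$ with finite mean and $\operatorname{ess\,sup}Z<+\infty$ is said to be calibrated by $\mathcal A_\alpha$ if, for iid copies $Z_1,\dots,Z_{n-1}$ of $Z$ and $Z_n=\operatorname{ess\,sup}Z$, $$\mathbb P\Big[\sup_{\mu\in\mathcal A_\alpha}\sum_{i=1}^n\mu_iZ_i\ \ge\ \mathbb E[Z]\Big]\ \ge\ 1-\delta ,$$ where $\sup\emptyset=-\infty$. For a random element $\xi$ and a family of losses $\ell(\theta,\cdot)$, $\theta\in\Theta$, such that each $\ell(\theta,\xi)$ has finite mean and finite essential supremum, let $\alpha_\star\in[-\infty,\infty]$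 be the infimum of all $\alpha\in\mathbb R$ for which $\mathcal A_\alpha$ calibrates $\ell(\theta,\xi)$ for every $\theta\in\Theta$. Let $\bar\alpha_\star$ be the infimum of all $\alpha\in\mathbb R$ for which $\mathcal A_\alpha$ calibrates every random variable $Z$ with finite mean and finite essential supremum. *Sampled radius.* Let $\phi^*(s)=\sup_{t\ge 0}\{ts-\phi(t)\}$ and, for $\nu\in\mathbb R^n$, $$I^\diamond_\phi(\nu)=\sup_{\lambda_1\le\dots\le\lambda_n}\ \sum_{i=1}^n\Big(\nu_i\lambda_i-\tfrac1n\phi^*(\lambda_i)\Big)\in[-\infty,\infty].$$ **Theorem.** Let $\alpha_1,\dots,\alpha_m$ be iid with the law of $I^\diamond_\phi(\nu)$, where $\nu$ is uniformly distributed on $\Delta^n$, and let $\alpha_{(1)}\le\dots\le\alpha_{(m)}$ be their order statistics. Then for every $k\in\{1,\dots,m\}$, $$\mathbb P\big[\alpha_\star\le\alpha_{(k)}\big]\ \ge\ 1-I_{1-\delta}(k,m-k+1)\qquad\text{and}\qquad \mathbb P\big[\bar\alpha_\star\le\alpha_{(k)}\big]\ \ge\ 1-I_{1-\delta}(k,m-k+1),$$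 where $I_x(a,b)$ is the regularized incomplete beta function, i.e. the cdf at $x$ of the beta distribution with parameters $a,b$. -/

import Mathlib

open MeasureTheory ProbabilityTheory

namespace DivergenceCalibration

/-- `φ : [0, ∞) → (-∞, ∞]` (only the values at `t ≥ 0` matter) generates a `φ`-divergence:
it is convex (its epigraph is convex), never `-∞`, vanishes at `1`, and is lower semicontinuous
at `1`.  The last condition holds automatically when `φ` is finite near `1`, and also when `φ` is
lower semicontinuous everywhere. -/
structure IsDivergenceGenerator (φ : ℝ → EReal) : Prop where
  convex_epigraph : Convex ℝ {p : ℝ × ℝ | 0 ≤ p.1 ∧ φ p.1 ≤ (p.2 : EReal)}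
  ne_bot : ∀ t, 0 ≤ t → φ t ≠ ⊥
  map_one : φ 1 = 0
  lsc_one : LowerSemicontinuousWithinAt φ (Set.Ici 0) 1

/-- The `φ`-divergence `I_φ(p, q) = ∑ i, q i * φ (p i / q i)`, for a strictly positive
reference vector `q`. -/
noncomputable def phiDivergence {n : ℕ} (φ : ℝ → EReal) (p q : Fin n → ℝ) : EReal :=
  ∑ i, (q i : EReal) * φ (p i / q i)

/-- The divergence ball `{μ ∈ Δⁿ | I_φ(μ, 1ₙ / n) ≤ α}` around the uniform weights. -/
def ambiguitySet (n : ℕ) (φ : ℝ → EReal) (α : ℝ) : Set (Fin n → ℝ) :=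
  {μ | μ ∈ stdSimplex ℝ (Fin n) ∧ phiDivergence φ μ (fun _ => 1 / (n : ℝ)) ≤ (α : EReal)}

/-- The support function `sup_{μ ∈ A} ∑ i, μ i * z i`; it is `-∞` when `A` is empty. -/
noncomputable def supportValue {n : ℕ} (A : Set (Fin n → ℝ)) (z : Fin n → ℝ) : EReal :=
  ⨆ μ ∈ A, ((∑ i, μ i * z i : ℝ) : EReal)

/-- `Z` is a random variable with a finite mean and a finite essential supremum. -/
structure IsAdmissible {Ω : Type*} [MeasurableSpace Ω] (P : Measure Ω) (Z : Ω → ℝ) : Prop where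
  measurable : Measurable Z
  integrable : Integrable Z P
  bddAbove : ∃ b : ℝ, ∀ᵐ ω ∂P, Z ω ≤ b

/-- With `n = N + 1`: the points `Z₁, …, Z_{n-1}, Zₙ`, where `Z₁, …, Z_{n-1}` are the values of
`Z` at the coordinates of `ω` and `Zₙ = ess sup Z`. -/
noncomputable def robustSample {Ω : Type*} [MeasurableSpace Ω] {N : ℕ} (P : Measure Ω)
    (Z : Ω → ℝ) (ω : Fin N → Ω) : Fin (N + 1) → ℝ :=
  Fin.snoc (α := fun _ => ℝ) (fun i => Z (ω i)) (essSup Z P)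

/-- The mean bound built from the weight set `A` and from `N = n - 1` iid samples of `Z`
(the coordinates of the product space) holds with probability at least `1 - δ`:
`ℙ[sup_{μ ∈ A} ∑ i, μ i * Z i ≥ 𝔼[Z]] ≥ 1 - δ`. -/
def IsCalibrated {Ω : Type*} [MeasurableSpace Ω] {N : ℕ} (A : Set (Fin (N + 1) → ℝ)) (δ : ℝ)
    (P : Measure Ω) (Z : Ω → ℝ) : Prop :=
  ENNReal.ofReal (1 - δ) ≤
    Measure.pi (fun _ : Fin N => P)
      {ω | ((∫ x, Z x ∂P : ℝ) : EReal) ≤ supportValue A (robustSample P Z ω)}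

/-- The smallest radius `α⋆` for which the divergence ball is calibrated for the
losses `ℓ θ`, for every parameter `θ`; an infimum in `[-∞, ∞]` over real radii. -/
noncomputable def calibrationRadius {Θ Ξ : Type*} [MeasurableSpace Ξ] (N : ℕ) (φ : ℝ → EReal)
    (δ : ℝ) (P : Measure Ξ) (l : Θ → Ξ → ℝ) : EReal :=
  ⨅ (α : ℝ) (_ : ∀ θ, IsCalibrated (ambiguitySet (N + 1) φ α) δ P (l θ)), (α : EReal)

/-- The smallest radius for which the divergence ball is calibrated for all random variables
with finite mean and finite essential supremum.  Calibration only depends on the law of `Z` on the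
real line, so probability spaces in the lowest universe realize all of them. -/
noncomputable def scalarCalibrationRadius (N : ℕ) (φ : ℝ → EReal) (δ : ℝ) : EReal :=
  ⨅ (α : ℝ) (_ : ∀ (Ω : Type) [MeasurableSpace Ω] (P : Measure Ω) [IsProbabilityMeasure P]
      (Z : Ω → ℝ), IsAdmissible P Z → IsCalibrated (ambiguitySet (N + 1) φ α) δ P Z), (α : EReal)

/-- The conjugate `φ*(s) = sup_{t ≥ 0} (t s - φ t)`. -/
noncomputable def conjugate (φ : ℝ → EReal) (s : ℝ) : EReal :=
  ⨆ (t : ℝ) (_ : 0 ≤ t), ((t * s : ℝ) : EReal) - φ t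

/-- `I⋄_φ(ν) = sup {∑ i, (ν i * y i - φ*(y i) / n) | y₁ ≤ ⋯ ≤ yₙ}`. -/
noncomputable def monotoneDivergence {n : ℕ} (φ : ℝ → EReal) (ν : Fin n → ℝ) : EReal :=
  ⨆ (y : Fin n → ℝ) (_ : Monotone y),
    ∑ i, (((ν i * y i : ℝ) : EReal) - ((1 / (n : ℝ) : ℝ) : EReal) * conjugate φ (y i))

/-- The uniform distribution on the probability simplex with `N + 1` vertices: the image of the
normalized Lebesgue measure on the solid simplex `{x ∈ ℝᴺ | x ≥ 0, ∑ x ≤ 1}` under the affine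
chart `x ↦ (x, 1 - ∑ x)`. -/
noncomputable def uniformSimplex (N : ℕ) : Measure (Fin (N + 1) → ℝ) :=
  (cond volume {x : Fin N → ℝ | (∀ i, 0 ≤ x i) ∧ ∑ i, x i ≤ 1}).map
    (fun x => Fin.snoc (α := fun _ => ℝ) x (1 - ∑ i, x i))

/-- The order statistics `a₍₁₎ ≤ ⋯ ≤ a₍ₘ₎` (indexed from `0` here). -/
noncomputable def orderStatistic {m : ℕ} (a : Fin m → EReal) (k : Fin m) : EReal :=
  a (Tuple.sort a k)

/-- The regularized incomplete beta function `I_x(a, b)`, the cdf of the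
beta distribution with parameters `a` and `b` at `x`. -/
noncomputable def regularizedIncompleteBeta (x a b : ℝ) : ℝ :=
  cdf (betaMeasure a b) x

end DivergenceCalibration

/-! ### Convex duality: weighted sums of sorted data against the support function of the ball. -/

namespace DivergenceCalibration

open Filter Topology

/-! Two facts drive the proof. The first is deterministic (`IsDivergenceGenerator.le_supportValue`):
if `I⋄_φ(ν) ≤ α` and `z` is sorted increasingly, then `∑ νᵢ zᵢ` is at most the support function of
the ball of radius `α` at `z`. In the Lagrangian dual, with multipliers `t > 0` and `b`, the
conjugate `φ*` enters only at the points `(zᵢ + b) / t`. These increase with `i`, so the supremum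
over monotone vectors in `I⋄_φ` covers them; `ν` itself need not lie in the ball.

The second is probabilistic. Write `Zᵢ = q(Uᵢ)` with `q` the quantile function and `Uᵢ` uniform on
`(0, 1)`. The mean `∫ q` is at most the upper Riemann sum of `q` on the grid of the sorted `Uᵢ`,
with `ess sup Z` on the last cell (`integral_le_sum_spacing`). Its weights are uniform on the
simplex whatever the law of `Z` (`cond_solidSimplex_le`). Hence every `α` with `ℙ[I⋄_φ(ν) ≤ α] ≥ 1 -
δ` is calibrated for all admissible `Z` (`IsAdmissible.isCalibrated`).

Consequently `ℙ[I⋄_φ(ν) < α⋆] ≤ 1 - δ`, for either radius `α⋆`. If `α₍ₖ₎ < α⋆`, then at least `k` of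
the `m` independent samples fall below the constant `α⋆`; the probability of this is at most a
binomial tail, which is a value of the incomplete beta function
(`binomialTail_eq_regularizedIncompleteBeta`). -/

lemma coe_finset_sum {ι : Type*} (s : Finset ι) (f : ι → ℝ) :
    ((∑ i ∈ s, f i : ℝ) : EReal) = ∑ i ∈ s, (f i : EReal) :=
  map_sum (⟨⟨Real.toEReal, EReal.coe_zero⟩, EReal.coe_add⟩ : ℝ →+ EReal) f s

/-- The epigraph of `φ` over `[0, ∞)`. -/
def epigraph (φ : ℝ → EReal) : Set (ℝ × ℝ) := {p | 0 ≤ p.1 ∧ φ p.1 ≤ (p.2 : EReal)}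

lemma IsDivergenceGenerator.one_mem {φ : ℝ → EReal} (hφ : IsDivergenceGenerator φ) :
    ((1, 0) : ℝ × ℝ) ∈ epigraph φ := by
  simp [epigraph, hφ.map_one]

lemma epigraph_mono {φ : ℝ → EReal} {x r r' : ℝ} (h : (x, r) ∈ epigraph φ) (hr : r ≤ r') :
    (x, r') ∈ epigraph φ :=
  ⟨h.1, h.2.trans (EReal.coe_le_coe_iff.2 hr)⟩

lemma IsDivergenceGenerator.notMem_closure_epigraph {φ : ℝ → EReal}
    (hφ : IsDivergenceGenerator φ) {η : ℝ} (hη : 0 < η) :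
    ((1, -η) : ℝ × ℝ) ∉ closure (epigraph φ) := by
  intro h
  have h1 : ∀ᶠ x in 𝓝[Set.Ici 0] (1 : ℝ), ((-(η / 2) : ℝ) : EReal) < φ x :=
    hφ.lsc_one _ (by
      change _ < φ 1
      rw [hφ.map_one]
      exact_mod_cast (by linarith : -(η / 2) < 0))
  rw [eventually_nhdsWithin_iff] at h1
  have h2 : ∀ᶠ p : ℝ × ℝ in 𝓝 (1, -η),
      p.1 ∈ Set.Ici (0 : ℝ) → ((-(η / 2) : ℝ) : EReal) < φ p.1 :=
    (continuous_fst.tendsto ((1 : ℝ), -η)).eventually h1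
  have h3 : ∀ᶠ p : ℝ × ℝ in 𝓝 (1, -η), p.2 < -(η / 2) :=
    (continuous_snd.tendsto ((1 : ℝ), -η)).eventually (gt_mem_nhds (by linarith : -η < -(η / 2)))
  obtain ⟨p, ⟨hp2, hp3⟩, hpE⟩ := mem_closure_iff_nhds.1 h _ (h2.and h3)
  have := (hp2 hpE.1).trans_le hpE.2
  exact absurd (EReal.coe_lt_coe_iff.1 this) (not_lt.2 hp3.le)

/-- Hahn–Banach at a point just below `(1, φ 1)`; the hyperplane is not vertical because `(1, 0)` is
in the epigraph. The slack `η` is needed since `φ` may have no subgradient at `1`. -/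
lemma IsDivergenceGenerator.exists_affine_minorant {φ : ℝ → EReal}
    (hφ : IsDivergenceGenerator φ) {η : ℝ} (hη : 0 < η) :
    ∃ s β : ℝ, (∀ p ∈ epigraph φ, s * p.1 - p.2 ≤ β) ∧ -η < s - β := by
  obtain ⟨f, u, hf, hu⟩ := geometric_hahn_banach_closed_point
    (Convex.closure hφ.convex_epigraph) isClosed_closure (hφ.notMem_closure_epigraph hη)
  have hlin : ∀ p : ℝ × ℝ, f p = f (1, 0) * p.1 + f (0, 1) * p.2 := fun p => by
    have : p = p.1 • ((1, 0) : ℝ × ℝ) + p.2 • ((0, 1) : ℝ × ℝ) := by ext <;> simp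
    conv_lhs => rw [this]
    simp only [map_add, map_smul, smul_eq_mul, mul_comm]
  set A := f (1, 0)
  set B := f (0, 1)
  rw [hlin] at hu
  have h0 := hf _ (subset_closure hφ.one_mem)
  rw [hlin] at h0
  simp only [mul_one, mul_zero, add_zero] at h0 hu
  have hB : 0 < -B := by
    by_contra h
    nlinarith
  refine ⟨A / (-B), u / (-B), fun p hp => ?_, ?_⟩
  · have := hf _ (subset_closure hp)
    rw [hlin] at this
    rw [div_mul_eq_mul_div, le_div_iff₀ hB, sub_mul, div_mul_cancel₀ _ hB.ne']
    linarith
  · rw [← sub_div, lt_div_iff₀ hB]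
    linarith

/-- Since `φ` need not be lower semicontinuous away from `1`, limit points of the epigraph may lie
outside it; an arbitrarily small contraction towards `(1, 0)` brings them back. -/
lemma IsDivergenceGenerator.contract_mem {φ : ℝ → EReal} (hφ : IsDivergenceGenerator φ)
    {x r τ : ℝ} (h : (x, r) ∈ closure (epigraph φ)) (hτ : 0 < τ) (hτ1 : τ < 1) :
    ((1 - τ) * x + τ, (1 - τ) * r) ∈ epigraph φ := by
  have hx : 0 ≤ x := closure_minimal (fun p hp => hp.1)
    (isClosed_le continuous_const continuous_fst) h
  by_cases hx1 : x = 1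
  · subst hx1
    have hr : 0 ≤ r := by
      refine le_of_forall_pos_lt_add fun η hη => ?_
      obtain ⟨s, β, hs, hsβ⟩ := hφ.exists_affine_minorant hη
      have : s * 1 - r ≤ β := closure_minimal (t := {p : ℝ × ℝ | s * p.1 - p.2 ≤ β}) hs
        (isClosed_le (by fun_prop) continuous_const) h
      linarith
    have := epigraph_mono hφ.one_mem (mul_nonneg (by linarith : 0 ≤ 1 - τ) hr)
    convert this using 2
    ring
  · refine ⟨add_nonneg (mul_nonneg (by linarith) hx) hτ.le, ?_⟩
    obtain ⟨p, hp, hlim⟩ := mem_closure_iff_seq_limit.1 h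
    have hl1 : Tendsto (fun k => (p k).1) atTop (𝓝 x) := (continuous_fst.tendsto _).comp hlim
    have hl2 : Tendsto (fun k => (p k).2) atTop (𝓝 r) := (continuous_snd.tendsto _).comp hlim
    have hne : x - 1 ≠ 0 := sub_ne_zero.2 hx1
    -- This weight makes the combination of `p k` and `(1, 0)` have first coordinate exactly `(1 -
    -- τ) * x + τ` for every `k`, so `φ` is bounded at a fixed point and no semicontinuity is needed
    -- there.
    have hθ : Tendsto (fun k => (1 - τ) * (x - 1) / ((p k).1 - 1)) atTop (𝓝 (1 - τ)) := by
      have := (tendsto_const_nhds (x := (1 - τ) * (x - 1))).div (hl1.sub_const 1) hne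
      rwa [mul_div_cancel_right₀ _ hne] at this
    have hlim2 := (continuous_coe_real_ereal.tendsto _).comp (hθ.mul hl2)
    refine ge_of_tendsto hlim2 ?_
    filter_upwards [hθ.eventually (lt_mem_nhds (by linarith : 0 < 1 - τ)),
      hθ.eventually (gt_mem_nhds (by linarith : 1 - τ < 1)),
      hl1.eventually (isOpen_ne.mem_nhds hx1)] with k h1 h2 h3
    have hk : (p k).1 - 1 ≠ 0 := sub_ne_zero.2 h3
    have hmem := hφ.convex_epigraph (hp k) hφ.one_mem h1.le (sub_nonneg.2 h2.le)
      (add_sub_cancel _ _)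
    have h4 := hmem.2
    simp only [Prod.fst_add, Prod.smul_fst, smul_eq_mul, Prod.snd_add, Prod.smul_snd,
      mul_zero, add_zero, mul_one] at h4
    refine le_of_eq_of_le (congrArg φ ?_) h4
    field_simp
    ring

/-- The supremum of a separable sum over independent arguments is the sum of the suprema. -/
lemma exists_separate_bounds {ι α : Type*} [Fintype ι] {E : Set α} (hE : E.Nonempty)
    (f : ι → α → ℝ) {Γ : ℝ} (h : ∀ p : ι → α, (∀ i, p i ∈ E) → ∑ i, f i (p i) ≤ Γ) :
    ∃ g : ι → ℝ, (∀ i, ∀ p ∈ E, f i p ≤ g i) ∧ ∑ i, g i ≤ Γ := by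
  classical
  obtain ⟨e, he⟩ := hE
  have hbdd : ∀ i, BddAbove (f i '' E) := fun i => by
    refine ⟨Γ - ∑ j ∈ Finset.univ \ {i}, f j e, ?_⟩
    rintro _ ⟨p, hp, rfl⟩
    have := h (Function.update (fun _ => e) i p) (fun j => by
      by_cases hj : j = i
      · subst hj; simpa
      · simpa [hj])
    rw [← Finset.sum_sdiff (Finset.subset_univ {i}), Finset.sum_singleton,
      Function.update_self] at this
    rw [Finset.sum_congr rfl (g := fun j => f j e) (fun j hj => by
      have : j ≠ i := by simpa using hj
      simp [this])] at this
    linarith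
  refine ⟨fun i => sSup (f i '' E), fun i p hp => le_csSup (hbdd i) ⟨p, hp, rfl⟩, ?_⟩
  refine le_of_forall_pos_le_add fun ε hε => ?_
  have hc : (0 : ℝ) < Fintype.card ι + 1 := by positivity
  have hex : ∀ i, ∃ p ∈ E, sSup (f i '' E) - ε / (Fintype.card ι + 1) < f i p := fun i => by
    obtain ⟨_, ⟨p, hp, rfl⟩, hlt⟩ := exists_lt_of_lt_csSup (Set.Nonempty.image (f i) ⟨e, he⟩)
      (sub_lt_self (sSup (f i '' E)) (div_pos hε hc))
    exact ⟨p, hp, hlt⟩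
  choose p hp hlt using hex
  have h1 := h p hp
  have h2 := Finset.sum_le_sum fun i (_ : i ∈ Finset.univ) => (hlt i).le
  rw [Finset.sum_sub_distrib, Finset.sum_const, Finset.card_univ, nsmul_eq_mul] at h2
  have h3 : (Fintype.card ι : ℝ) * (ε / (Fintype.card ι + 1)) ≤ ε := by
    rw [mul_div_assoc', div_le_iff₀ hc]
    nlinarith
  linarith

/-- The values `(∑ xᵢ, ∑ rᵢ, w)` with `w ≤ ∑ zᵢ xᵢ`, where `(xᵢ, rᵢ)` are in the epigraph. -/
def perturbationSet {ι : Type*} [Fintype ι] (φ : ℝ → EReal) (z : ι → ℝ) : Set (ℝ × ℝ × ℝ) :=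
  {q | ∃ p : ι → ℝ × ℝ, (∀ i, p i ∈ epigraph φ) ∧ ∑ i, (p i).1 = q.1 ∧ ∑ i, (p i).2 = q.2.1 ∧
    q.2.2 ≤ ∑ i, z i * (p i).1}

lemma IsDivergenceGenerator.convex_perturbationSet {ι : Type*} [Fintype ι] {φ : ℝ → EReal}
    (hφ : IsDivergenceGenerator φ) (z : ι → ℝ) : Convex ℝ (perturbationSet φ z) := by
  rintro q ⟨p, hp, h1, h2, h3⟩ q' ⟨p', hp', h1', h2', h3'⟩ a b ha hb hab
  refine ⟨fun i => a • p i + b • p' i,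
    fun i => hφ.convex_epigraph (hp i) (hp' i) ha hb hab, ?_, ?_, ?_⟩
  · simp [Finset.sum_add_distrib, ← Finset.mul_sum, h1, h1']
  · simp [Finset.sum_add_distrib, ← Finset.mul_sum, h2, h2']
  · have : ∑ i, z i * (a • p i + b • p' i).1
        = a * ∑ i, z i * (p i).1 + b * ∑ i, z i * (p' i).1 := by
      simp only [Finset.mul_sum, ← Finset.sum_add_distrib]
      refine Finset.sum_congr rfl fun i _ => ?_
      simp
      ring
    rw [this]
    simp only [Prod.snd_add, Prod.smul_snd, smul_eq_mul]
    gcongr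

/-- Strong duality up to closure: `H` is the dual bound, with `g i` standing for `φ*((z i + b) /
t)`. A hyperplane separating the target point from the set would supply multipliers `t`, `b`
violating `H`. -/
lemma IsDivergenceGenerator.mem_closure_perturbationSet {ι : Type*} [Fintype ι] [Nonempty ι]
    {φ : ℝ → EReal} (hφ : IsDivergenceGenerator φ) (z : ι → ℝ) {c α : ℝ} (hα : 0 ≤ α)
    (H : ∀ (t b : ℝ) (g : ι → ℝ), 0 < t →
      (∀ i, ∀ p ∈ epigraph φ, (z i + b) / t * p.1 - p.2 ≤ g i) →
      (c + b) / t - (∑ i, g i) / Fintype.card ι ≤ α) :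
    ((Fintype.card ι : ℝ), (Fintype.card ι : ℝ) * α, (Fintype.card ι : ℝ) * c) ∈
      closure (perturbationSet φ z) := by
  by_contra hcon
  obtain ⟨f, u, hf, hu⟩ := geometric_hahn_banach_closed_point
    (hφ.convex_perturbationSet z).closure isClosed_closure hcon
  have hlin : ∀ p : ℝ × ℝ × ℝ,
      f p = f (1, 0, 0) * p.1 + f (0, 1, 0) * p.2.1 + f (0, 0, 1) * p.2.2 := fun p => by
    have : p = p.1 • ((1, 0, 0) : ℝ × ℝ × ℝ) + p.2.1 • ((0, 1, 0) : ℝ × ℝ × ℝ)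
        + p.2.2 • ((0, 0, 1) : ℝ × ℝ × ℝ) := by ext <;> simp
    conv_lhs => rw [this]
    simp only [map_add, map_smul, smul_eq_mul, mul_comm]
  set A := f (1, 0, 0)
  set B := f (0, 1, 0)
  set C := f (0, 0, 1)
  set n : ℝ := (Fintype.card ι : ℝ) with hn
  have hn0 : 0 < n := by rw [hn]; exact_mod_cast Fintype.card_pos
  rw [hlin] at hu
  simp only at hu
  have hK : ∀ (p : ι → ℝ × ℝ) (v : ℝ), (∀ i, p i ∈ epigraph φ) → 0 ≤ v →
      A * ∑ i, (p i).1 + B * ∑ i, (p i).2 + C * ((∑ i, z i * (p i).1) - v) < u := by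
    intro p v hp hv
    have := hf (∑ i, (p i).1, ∑ i, (p i).2, (∑ i, z i * (p i).1) - v)
      (subset_closure ⟨p, hp, rfl, rfl, by simpa using hv⟩)
    rwa [hlin] at this
  have hK1 : ∀ R v : ℝ, 0 ≤ R → 0 ≤ v →
      A * n + B * (n * R) + C * ((∑ i, z i) - v) < u := by
    intro R v hR hv
    have := hK (fun _ => (1, R)) v (fun _ => epigraph_mono hφ.one_mem hR) hv
    simpa [← hn] using this
  have hB : B ≤ 0 := by
    by_contra! h
    have h0 := hK1 0 0 le_rfl le_rfl
    set X := A * n + C * ((∑ i, z i) - 0)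
    have hX : 0 < u - X := by
      simp only [mul_zero, add_zero] at h0
      simp only [X]
      linarith
    have := hK1 ((u - X) / (B * n)) 0 (by positivity) le_rfl
    have h2 : B * (n * ((u - X) / (B * n))) = u - X := by field_simp
    rw [h2] at this
    simp only [X] at this
    linarith
  have hC0 : 0 ≤ C := by
    by_contra! h
    have h0 := hK1 0 0 le_rfl le_rfl
    set X := A * n + C * (∑ i, z i) with hX'
    have hX : 0 < u - X := by
      simp only [mul_zero, add_zero, sub_zero] at h0
      linarith
    have := hK1 0 ((u - X) / (-C)) le_rfl (div_nonneg hX.le (by linarith))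
    have h2 : C * ((u - X) / (-C)) = -(u - X) := by
      rw [div_neg, mul_neg, mul_div_cancel₀ _ h.ne]
    rw [mul_sub, h2] at this
    linarith
  -- If `C = 0`, the feasible choice `xᵢ = 1`, `rᵢ = 0` already contradicts the separation; this
  -- uses `0 ≤ α`.
  have hC : 0 < C := by
    refine lt_of_le_of_ne hC0 fun h => ?_
    have h0 := hK1 0 0 le_rfl le_rfl
    rw [← h] at h0 hu
    have := mul_nonneg hn0.le hα
    nlinarith
  obtain ⟨s, β, hs, -⟩ := hφ.exists_affine_minorant one_pos
  set ε := A * n + B * (n * α) + C * (n * c) - u with hε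
  have hε0 : 0 < ε := by linarith
  set D := |n * α - n * s + n * β| + 1 with hD
  have hD0 : 0 < D := by positivity
  -- `B` may vanish, so `κ` times the affine minorant is added to make the divergence multiplier `κ
  -- - B` positive. The choice costs at most `κ * D = ε / 2`, half the separation gap `ε`.
  set κ := ε / (2 * D) with hκ
  have hκ0 : 0 < κ := by positivity
  have hκB : 0 < κ - B := by linarith
  obtain ⟨g, hg, hgs⟩ := exists_separate_bounds (ι := ι) ⟨_, hφ.one_mem⟩
    (fun i p => (z i + (A + κ * s) / C) / ((κ - B) / C) * p.1 - p.2)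
    (Γ := (u + κ * (n * β)) / (κ - B)) (fun p hp => by
      have h1 := hK p 0 hp le_rfl
      have h2 : s * ∑ i, (p i).1 - ∑ i, (p i).2 ≤ n * β := by
        have := Finset.sum_le_sum fun i (_ : i ∈ Finset.univ) => hs _ (hp i)
        rwa [Finset.sum_sub_distrib, ← Finset.mul_sum, Finset.sum_const, Finset.card_univ,
          nsmul_eq_mul, ← hn] at this
      have h3 : ∑ i, ((z i + (A + κ * s) / C) / ((κ - B) / C) * (p i).1 - (p i).2)
          = (C * ∑ i, z i * (p i).1 + (A + κ * s) * ∑ i, (p i).1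
            - (κ - B) * ∑ i, (p i).2) / (κ - B) := by
        rw [Finset.mul_sum, Finset.mul_sum, Finset.mul_sum, ← Finset.sum_add_distrib,
          ← Finset.sum_sub_distrib, Finset.sum_div]
        refine Finset.sum_congr rfl fun i _ => ?_
        have := hκB.ne'
        field_simp
      rw [h3]
      gcongr
      nlinarith)
  have hfin := H _ _ g (by positivity) hg
  have h5 : (c + (A + κ * s) / C) / ((κ - B) / C) = (C * c + A + κ * s) / (κ - B) := by
    field_simp
    ring
  rw [h5] at hfin
  have h6 : (∑ i, g i) / n ≤ (u + κ * (n * β)) / (κ - B) / n := by gcongr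
  have h7 : (C * c + A + κ * s) / (κ - B) - (u + κ * (n * β)) / (κ - B) / n ≤ α := by linarith
  have h8 : (C * c + A + κ * s) / (κ - B) - (u + κ * (n * β)) / (κ - B) / n
      = ((C * c + A + κ * s) * n - (u + κ * (n * β))) / (n * (κ - B)) := by
    field_simp
  rw [h8, div_le_iff₀ (by positivity)] at h7
  have h9 : ε ≤ κ * (n * α - n * s + n * β) := by
    rw [hε]
    linarith
  have h10 : κ * (n * α - n * s + n * β) ≤ κ * D := by
    gcongr
    rw [hD]
    linarith [le_abs_self (n * α - n * s + n * β)]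
  have h11 : κ * D = ε / 2 := by
    rw [hκ]
    field_simp
  linarith

/-- Compactness: the `xᵢ` are nonnegative with bounded sum, the affine minorant then bounds each
`rᵢ` below, and the bounded sum of the `rᵢ` bounds each above. -/
lemma IsDivergenceGenerator.exists_of_mem_closure_perturbationSet {ι : Type*} [Fintype ι]
    {φ : ℝ → EReal} (hφ : IsDivergenceGenerator φ) {z : ι → ℝ} {q : ℝ × ℝ × ℝ}
    (hq : q ∈ closure (perturbationSet φ z)) :
    ∃ p : ι → ℝ × ℝ, (∀ i, p i ∈ closure (epigraph φ)) ∧ ∑ i, (p i).1 = q.1 ∧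
      ∑ i, (p i).2 = q.2.1 ∧ q.2.2 ≤ ∑ i, z i * (p i).1 := by
  obtain ⟨v, hv, hlim⟩ := mem_closure_iff_seq_limit.1 hq
  choose p hp h1 h2 h3 using hv
  obtain ⟨R, hR⟩ := (Metric.isBounded_range_of_tendsto v hlim).exists_norm_le
  obtain ⟨s, β, hs, -⟩ := hφ.exists_affine_minorant one_pos
  have hR' : ∀ k, ‖v k‖ ≤ R := fun k => hR _ ⟨k, rfl⟩
  have hR0 : 0 ≤ R := (norm_nonneg _).trans (hR' 0)
  have hx : ∀ k i, (p k i).1 ≤ R := fun k i => by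
    have h4 : (p k i).1 ≤ ∑ i, (p k i).1 :=
      Finset.single_le_sum (f := fun i => (p k i).1) (fun i _ => (hp k i).1) (Finset.mem_univ i)
    rw [h1] at h4
    exact h4.trans ((le_abs_self _).trans ((norm_fst_le (v k)).trans (hR' k)))
  set M := |s| * R + |β| with hM
  have hM0 : 0 ≤ M := by positivity
  have hlow : ∀ k i, -M ≤ (p k i).2 := fun k i => by
    have h4 := hs _ (hp k i)
    have h5 : -(|s| * R) ≤ s * (p k i).1 := by
      have : |s * (p k i).1| ≤ |s| * R := by
        rw [abs_mul, abs_of_nonneg (hp k i).1]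
        exact mul_le_mul_of_nonneg_left (hx k i) (abs_nonneg _)
      linarith [neg_abs_le (s * (p k i).1)]
    have := le_abs_self β
    rw [hM]
    linarith
  have hup : ∀ k i, (p k i).2 ≤ R + Fintype.card ι * M := fun k i => by
    have h4 : (p k i).2 + M ≤ ∑ i, ((p k i).2 + M) :=
      Finset.single_le_sum (f := fun i => (p k i).2 + M)
        (fun i _ => by linarith [hlow k i]) (Finset.mem_univ i)
    rw [Finset.sum_add_distrib, h2, Finset.sum_const, Finset.card_univ, nsmul_eq_mul] at h4
    have h5 : (v k).2.1 ≤ R := (le_abs_self _).trans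
      ((norm_fst_le (v k).2).trans ((norm_snd_le (v k)).trans (hR' k)))
    linarith
  have hb : ∀ k, p k ∈ Metric.closedBall (0 : ι → ℝ × ℝ) (R + Fintype.card ι * M + M) := by
    intro k
    have hcM : 0 ≤ (Fintype.card ι : ℝ) * M := by positivity
    rw [mem_closedBall_zero_iff, pi_norm_le_iff_of_nonneg (by positivity)]
    intro i
    rw [Prod.norm_def, max_le_iff, Real.norm_eq_abs, Real.norm_eq_abs, abs_le, abs_le]
    refine ⟨⟨?_, ?_⟩, ?_, ?_⟩
    · linarith [(hp k i).1]
    · linarith [hx k i]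
    · linarith [hlow k i]
    · linarith [hup k i]
  obtain ⟨P, -, σ, hσ, hP⟩ := (isCompact_closedBall (0 : ι → ℝ × ℝ) _).tendsto_subseq hb
  have hlimσ := hlim.comp hσ.tendsto_atTop
  have hPi : ∀ i, Tendsto (fun k => p (σ k) i) atTop (𝓝 (P i)) := fun i =>
    (tendsto_pi_nhds.1 hP) i
  have hP1 : ∀ i, Tendsto (fun k => (p (σ k) i).1) atTop (𝓝 (P i).1) := fun i =>
    (continuous_fst.tendsto _).comp (hPi i)
  have hP2 : ∀ i, Tendsto (fun k => (p (σ k) i).2) atTop (𝓝 (P i).2) := fun i =>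
    (continuous_snd.tendsto _).comp (hPi i)
  refine ⟨P, fun i => mem_closure_of_tendsto (hPi i) (Eventually.of_forall fun k => hp _ i),
    ?_, ?_, ?_⟩
  · refine tendsto_nhds_unique (tendsto_finsetSum _ fun i _ => hP1 i) ?_
    simp only [h1]
    exact (continuous_fst.tendsto _).comp hlimσ
  · refine tendsto_nhds_unique (tendsto_finsetSum _ fun i _ => hP2 i) ?_
    simp only [h2]
    exact (continuous_fst.tendsto _).comp ((continuous_snd.tendsto _).comp hlimσ)
  · refine le_of_tendsto_of_tendsto'
      ((continuous_snd.tendsto _).comp ((continuous_snd.tendsto _).comp hlimσ))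
      (tendsto_finsetSum _ fun i _ => (hP1 i).const_mul (z i)) fun k => h3 _

lemma IsDivergenceGenerator.conjugate_le {φ : ℝ → EReal} (hφ : IsDivergenceGenerator φ)
    {s g : ℝ} (h : ∀ p ∈ epigraph φ, s * p.1 - p.2 ≤ g) : conjugate φ s ≤ g := by
  refine iSup₂_le fun t ht => ?_
  have hbot := hφ.ne_bot t ht
  induction hr : φ t using EReal.rec with
  | bot => exact absurd hr hbot
  | top => simp
  | coe r =>
    have := h (t, r) ⟨ht, hr.le⟩
    rw [← EReal.coe_sub, EReal.coe_le_coe_iff]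
    linarith

lemma IsDivergenceGenerator.le_monotoneDivergence {n : ℕ} {φ : ℝ → EReal}
    (hφ : IsDivergenceGenerator φ) (ν y g : Fin n → ℝ) (hy : Monotone y)
    (h : ∀ i, ∀ p ∈ epigraph φ, y i * p.1 - p.2 ≤ g i) :
    ((∑ i, ν i * y i - (∑ i, g i) / n : ℝ) : EReal) ≤ monotoneDivergence φ ν := by
  refine le_trans ?_ (le_iSup₂ (f := fun (y : Fin n → ℝ) (_ : Monotone y) =>
    ∑ i, (((ν i * y i : ℝ) : EReal) - ((1 / (n : ℝ) : ℝ) : EReal) * conjugate φ (y i))) y hy)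
  rw [Finset.sum_div, ← Finset.sum_sub_distrib, coe_finset_sum]
  refine Finset.sum_le_sum fun i _ => ?_
  rw [EReal.coe_sub]
  refine EReal.sub_le_sub le_rfl ?_
  rw [← one_div_mul_eq_div (n : ℝ) (g i), EReal.coe_mul]
  have hn : (0 : ℝ) ≤ 1 / n := by positivity
  exact mul_le_mul_of_nonneg_left (hφ.conjugate_le (h i)) (EReal.coe_nonneg.2 hn)

/-- Test `I⋄_φ` with the constant vector whose value is the slope of an almost supporting line at
`1`. -/
lemma IsDivergenceGenerator.nonneg_of_monotoneDivergence_le {n : ℕ} (hn : n ≠ 0)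
    {φ : ℝ → EReal} (hφ : IsDivergenceGenerator φ) {ν : Fin n → ℝ} (hν : ∑ i, ν i = 1) {α : ℝ}
    (h : monotoneDivergence φ ν ≤ α) : 0 ≤ α := by
  refine le_of_forall_pos_lt_add fun η hη => ?_
  obtain ⟨s, β, hs, hsβ⟩ := hφ.exists_affine_minorant hη
  have h1 := (hφ.le_monotoneDivergence ν (fun _ => s) (fun _ => β) monotone_const
    fun _ => hs).trans h
  rw [EReal.coe_le_coe_iff, ← Finset.sum_mul, hν, Finset.sum_const, Finset.card_univ,
    Fintype.card_fin, nsmul_eq_mul, mul_div_cancel_left₀ _ (by exact_mod_cast hn)] at h1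
  linarith

lemma mem_ambiguitySet_of_epigraph {n : ℕ} (hn : n ≠ 0) {φ : ℝ → EReal} {α : ℝ}
    (p : Fin n → ℝ × ℝ) (hp : ∀ i, p i ∈ epigraph φ) (h1 : ∑ i, (p i).1 = n)
    (h2 : ∑ i, (p i).2 ≤ n * α) : (fun i => (p i).1 / n) ∈ ambiguitySet n φ α := by
  have hn' : (0 : ℝ) < n := by positivity
  refine ⟨⟨fun i => div_nonneg (hp i).1 hn'.le, ?_⟩, ?_⟩
  · rw [← Finset.sum_div, h1, div_self hn'.ne']
  · have h3 : ((∑ i, (1 / n : ℝ) * (p i).2 : ℝ) : EReal) ≤ α := by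
      rw [EReal.coe_le_coe_iff, ← Finset.mul_sum, one_div, inv_mul_le_iff₀ hn']
      exact h2
    refine le_trans ?_ h3
    rw [coe_finset_sum]
    refine Finset.sum_le_sum fun i _ => ?_
    rw [EReal.coe_mul]
    have h4 : (p i).1 / n / (1 / n) = (p i).1 := by field_simp
    rw [h4]
    exact mul_le_mul_of_nonneg_left (hp i).2 (EReal.coe_nonneg.2 (by positivity))

lemma ambiguitySet_comp_perm {n : ℕ} {φ : ℝ → EReal} {α : ℝ} {μ : Fin n → ℝ}
    (h : μ ∈ ambiguitySet n φ α) (σ : Equiv.Perm (Fin n)) : μ ∘ σ ∈ ambiguitySet n φ α := by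
  refine ⟨⟨fun i => h.1.1 _, ?_⟩, ?_⟩
  · rw [← h.1.2]
    exact Equiv.sum_comp σ μ
  · refine le_of_eq_of_le ?_ h.2
    exact Equiv.sum_comp σ fun i => ((1 / (n : ℝ) : ℝ) : EReal) * φ (μ i / (1 / (n : ℝ)))

theorem IsDivergenceGenerator.le_supportValue {n : ℕ} (hn : n ≠ 0) {φ : ℝ → EReal}
    (hφ : IsDivergenceGenerator φ) {ν : Fin n → ℝ} (hν : ∑ i, ν i = 1) {α : ℝ}
    (h : monotoneDivergence φ ν ≤ α) (z : Fin n → ℝ) (σ : Equiv.Perm (Fin n))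
    (hz : Monotone (z ∘ σ)) :
    ((∑ i, ν i * z (σ i) : ℝ) : EReal) ≤ supportValue (ambiguitySet n φ α) z := by
  have : Nonempty (Fin n) := ⟨⟨0, Nat.pos_of_ne_zero hn⟩⟩
  have hn' : (0 : ℝ) < n := by positivity
  have hα := hφ.nonneg_of_monotoneDivergence_le hn hν h
  have hmem := hφ.mem_closure_perturbationSet (z ∘ σ) (c := ∑ i, ν i * z (σ i)) hα
    (fun t b g ht hg => by
      have h1 := (hφ.le_monotoneDivergence ν (fun i => (z (σ i) + b) / t) g
        (fun i j hij => by
          have := hz hij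
          simp only [Function.comp] at this
          dsimp only
          gcongr) hg).trans h
      rw [EReal.coe_le_coe_iff] at h1
      have h2 : ∑ i, ν i * ((z (σ i) + b) / t) = (∑ i, ν i * z (σ i) + b) / t := by
        have : ∀ i, ν i * ((z (σ i) + b) / t) = ν i * z (σ i) / t + ν i * (b / t) :=
          fun i => by ring
        simp only [this, Finset.sum_add_distrib]
        rw [← Finset.sum_mul, hν, ← Finset.sum_div]
        ring
      rw [h2] at h1
      simpa using h1)
  obtain ⟨p, hp, h1, h2, h3⟩ := hφ.exists_of_mem_closure_perturbationSet hmem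
  simp only [Fintype.card_fin] at h1 h2 h3
  set c := ∑ i, ν i * z (σ i) with hc
  -- The optimizer found above lies only in the closed epigraph. Contracting it by `τ` gives a point
  -- of the ball, permuted back by `σ`; the loss vanishes as `τ → 0`.
  have key : ∀ τ : ℝ, 0 < τ → τ < 1 →
      (((1 - τ) * c + τ * ((∑ i, z (σ i)) / n) : ℝ) : EReal) ≤
        supportValue (ambiguitySet n φ α) z := by
    intro τ hτ hτ1
    have hA := mem_ambiguitySet_of_epigraph hn (α := α)
      (fun i => ((1 - τ) * (p i).1 + τ, (1 - τ) * (p i).2))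
      (fun i => hφ.contract_mem (hp i) hτ hτ1)
      (by
        simp only [Finset.sum_add_distrib, ← Finset.mul_sum, h1]
        simp
        ring)
      (by
        simp only [← Finset.mul_sum, h2]
        have : 0 ≤ n * α := by positivity
        nlinarith)
    have hA' := ambiguitySet_comp_perm hA σ.symm
    refine le_trans ?_ (le_iSup₂ (f := fun (μ : Fin n → ℝ) (_ : μ ∈ ambiguitySet n φ α) =>
      ((∑ i, μ i * z i : ℝ) : EReal)) _ hA')
    rw [EReal.coe_le_coe_iff, ← Equiv.sum_comp σ (fun i => _ * z i)]
    simp only [Function.comp, Equiv.symm_apply_apply] at h3 ⊢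
    have h4 : ∑ i, ((1 - τ) * (p i).1 + τ) / n * z (σ i)
        = (1 - τ) * ((∑ i, z (σ i) * (p i).1) / n) + τ * ((∑ i, z (σ i)) / n) := by
      rw [Finset.sum_div, Finset.sum_div, Finset.mul_sum, Finset.mul_sum,
        ← Finset.sum_add_distrib]
      exact Finset.sum_congr rfl fun i _ => by ring
    rw [h4]
    have h5 : c ≤ (∑ i, z (σ i) * (p i).1) / n := by
      rw [le_div_iff₀ hn']
      linarith
    have : 0 ≤ 1 - τ := by linarith
    gcongr
  have hlim : Tendsto (fun τ : ℝ => (((1 - τ) * c + τ * ((∑ i, z (σ i)) / n) : ℝ) : EReal))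
      (𝓝[>] 0) (𝓝 (c : EReal)) := by
    refine (continuous_coe_real_ereal.tendsto _).comp ?_
    have : Continuous fun τ : ℝ => (1 - τ) * c + τ * ((∑ i, z (σ i)) / n) := by fun_prop
    have h0 := this.tendsto 0
    simp only [sub_zero, one_mul, zero_mul, add_zero] at h0
    exact h0.mono_left nhdsWithin_le_nhds
  refine le_of_tendsto hlim ?_
  filter_upwards [Ioo_mem_nhdsGT (zero_lt_one' ℝ)] with τ hτ
  exact key τ hτ.1 hτ.2

end DivergenceCalibration

/-! ### Spacings of uniform points and the uniform law on the simplex. -/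

namespace DivergenceCalibration

/-- The consecutive differences `v₀ - 0, v₁ - v₀, …`. -/
def spacing (N : ℕ) : (Fin N → ℝ) →ₗ[ℝ] (Fin N → ℝ) where
  toFun v i := v i - Fin.cons (α := fun _ => ℝ) 0 v i.castSucc
  map_add' v w := by
    have h : ∀ j : Fin (N + 1), Fin.cons (α := fun _ => ℝ) 0 (v + w) j =
        Fin.cons (α := fun _ => ℝ) 0 v j + Fin.cons (α := fun _ => ℝ) 0 w j :=
      fun j => by cases j using Fin.cases <;> simp
    ext i
    simp only [h, Pi.add_apply]
    ring
  map_smul' c v := by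
    have h : ∀ j : Fin (N + 1), Fin.cons (α := fun _ => ℝ) 0 (c • v) j =
        c * Fin.cons (α := fun _ => ℝ) 0 v j :=
      fun j => by cases j using Fin.cases <;> simp
    ext i
    simp only [h, Pi.smul_apply, smul_eq_mul, RingHom.id_apply]
    ring

lemma spacing_apply {N : ℕ} (v : Fin N → ℝ) (i : Fin N) :
    spacing N v i = v i - Fin.cons (α := fun _ => ℝ) 0 v i.castSucc := rfl

lemma sum_succ_sub_castSucc {N : ℕ} (e : Fin (N + 1) → ℝ) :
    ∑ i : Fin N, (e i.succ - e i.castSucc) = e (Fin.last N) - e 0 := by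
  have h1 := Fin.sum_univ_succ e
  have h2 := Fin.sum_univ_castSucc e
  rw [Finset.sum_sub_distrib]
  linarith

/-- The matrix is lower triangular with unit diagonal. -/
lemma det_spacing (N : ℕ) : LinearMap.det (spacing N) = 1 := by
  have hcons : ∀ (i j : Fin N), i ≤ j →
      Fin.cons (α := fun _ => ℝ) 0 (Pi.single j (1 : ℝ)) i.castSucc = 0 := by
    intro i j hij
    induction hx : i.castSucc using Fin.cases with
    | zero => rfl
    | succ k =>
      rw [Fin.cons_succ, Pi.single_apply, if_neg]
      rintro rfl
      have := congrArg Fin.val hx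
      simp only [Fin.val_castSucc, Fin.val_succ] at this
      have h3 : (i : ℕ) ≤ k := hij
      omega
  rw [← LinearMap.det_toMatrix', Matrix.det_of_isLowerTriangular]
  · refine Finset.prod_eq_one fun i _ => ?_
    rw [LinearMap.toMatrix'_apply, spacing_apply]
    simp only [hcons i i le_rfl]
    simp
  · intro i j hij
    have hij' : i < j := hij
    rw [LinearMap.toMatrix'_apply, spacing_apply]
    simp [hcons i j hij'.le, hij'.ne]

lemma measurePreserving_spacing (N : ℕ) : MeasurePreserving (spacing N) := by
  refine ⟨(LinearMap.continuous_of_finiteDimensional _).measurable, ?_⟩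
  rw [Real.map_linearMap_volume_pi_eq_smul_volume_pi (by simp [det_spacing]), det_spacing]
  simp

lemma measurePreserving_comp_perm {ι : Type*} [Fintype ι] (σ : Equiv.Perm ι) :
    MeasurePreserving (fun u : ι → ℝ => u ∘ σ) :=
  volume_preserving_arrowCongr' σ.symm (MeasurableEquiv.refl ℝ) (MeasurePreserving.id volume)

/-- The solid simplex `{x ∈ ℝᴺ | x ≥ 0, ∑ x ≤ 1}`. -/
def solidSimplex (N : ℕ) : Set (Fin N → ℝ) := {x | (∀ i, 0 ≤ x i) ∧ ∑ i, x i ≤ 1}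

lemma measurableSet_solidSimplex (N : ℕ) : MeasurableSet (solidSimplex N) := by
  refine IsClosed.measurableSet ?_
  have h : solidSimplex N = (⋂ i, {x | 0 ≤ x i}) ∩ {x | ∑ i, x i ≤ 1} := by
    ext
    simp [solidSimplex]
  rw [h]
  exact (isClosed_iInter fun i => isClosed_le (by fun_prop) (by fun_prop)).inter
    (isClosed_le (by fun_prop) (by fun_prop))

lemma spacing_mem_solidSimplex_iff {N : ℕ} {v : Fin N → ℝ} :
    spacing N v ∈ solidSimplex N ↔ Monotone v ∧ ∀ i, v i ∈ Set.Icc (0 : ℝ) 1 := by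
  set e : Fin (N + 1) → ℝ := Fin.cons (α := fun _ => ℝ) 0 v with he
  have hs : ∀ i, spacing N v i = e i.succ - e i.castSucc := fun i => rfl
  have h0 : e 0 = 0 := rfl
  have hsum : ∑ i, spacing N v i = e (Fin.last N) := by
    simp only [hs, sum_succ_sub_castSucc, h0, sub_zero]
  rw [solidSimplex, Set.mem_ofPred_eq, hsum]
  constructor
  · rintro ⟨h1, h2⟩
    have hmono : Monotone e := Fin.monotone_iff_le_succ.2 fun i => by
      have := h1 i
      rw [hs] at this
      linarith
    refine ⟨fun i j hij => hmono (Fin.succ_le_succ_iff.2 hij), fun i => ⟨?_, ?_⟩⟩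
    · exact hmono (Fin.zero_le i.succ)
    · exact (hmono (Fin.le_last i.succ)).trans h2
  · rintro ⟨h1, h2⟩
    constructor
    · intro i
      rw [hs, sub_nonneg]
      induction hx : i.castSucc using Fin.cases with
      | zero => exact (h2 i).1
      | succ k =>
        have := congrArg Fin.val hx
        simp only [Fin.val_castSucc, Fin.val_succ] at this
        change v k ≤ v i
        exact h1 (Fin.le_def.2 (by omega))
    · induction hx : Fin.last N using Fin.cases with
      | zero => rw [h0]; exact zero_le_one
      | succ k => exact (h2 k).2

lemma volume_setOf_apply_eq_apply {ι : Type*} [Fintype ι] {i j : ι} (hij : i ≠ j) :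
    volume {u : ι → ℝ | u i = u j} = 0 := by
  classical
  have h : {u : ι → ℝ | u i = u j} =
      (LinearMap.ker (LinearMap.proj (R := ℝ) (φ := fun _ : ι => ℝ) i - LinearMap.proj j) :
        Submodule ℝ (ι → ℝ)) := by
    ext u
    simp [sub_eq_zero]
  rw [h]
  refine Measure.addHaar_submodule _ _ fun htop => ?_
  have := htop ▸ Submodule.mem_top (x := Pi.single i (1 : ℝ))
  simp [hij.symm] at this

/-- The points whose coordinates, sorted by `σ`, have their spacings in `G`. -/
def sortedRegion {N : ℕ} (G : Set (Fin N → ℝ)) (σ : Equiv.Perm (Fin N)) : Set (Fin N → ℝ) :=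
  {u | spacing N (u ∘ σ) ∈ solidSimplex N ∩ G}

lemma measurePreserving_spacing_comp {N : ℕ} (σ : Equiv.Perm (Fin N)) :
    MeasurePreserving (fun u : Fin N → ℝ => spacing N (u ∘ σ)) :=
  (measurePreserving_spacing N).comp (measurePreserving_comp_perm σ)

lemma measurableSet_sortedRegion {N : ℕ} {G : Set (Fin N → ℝ)} (hG : MeasurableSet G)
    (σ : Equiv.Perm (Fin N)) : MeasurableSet (sortedRegion G σ) :=
  (measurePreserving_spacing_comp σ).measurable ((measurableSet_solidSimplex N).inter hG)

lemma volume_sortedRegion {N : ℕ} {G : Set (Fin N → ℝ)} (hG : MeasurableSet G)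
    (σ : Equiv.Perm (Fin N)) : volume (sortedRegion G σ) = volume (solidSimplex N ∩ G) :=
  (measurePreserving_spacing_comp σ).measure_preimage
    ((measurableSet_solidSimplex N).inter hG).nullMeasurableSet

/-- Two permutations sorting the same point give the same sorted vector, so where they differ two
coordinates of the point coincide. -/
lemma aedisjoint_sortedRegion {N : ℕ} (G : Set (Fin N → ℝ)) {σ τ : Equiv.Perm (Fin N)}
    (h : σ ≠ τ) : AEDisjoint volume (sortedRegion G σ) (sortedRegion G τ) := by
  refine measure_mono_null (t := ⋃ i : Fin N, ⋃ j : Fin N, ⋃ _ : i ≠ j, {u | u i = u j}) ?_ ?_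
  · rintro u ⟨hσ, hτ⟩
    have h1 := (spacing_mem_solidSimplex_iff.1 hσ.1).1
    have h2 := (spacing_mem_solidSimplex_iff.1 hτ.1).1
    have h3 := Tuple.unique_monotone h1 h2
    obtain ⟨i, hi⟩ : ∃ i, σ i ≠ τ i := by
      by_contra! hc
      exact h (Equiv.ext hc)
    simp only [Set.mem_iUnion]
    exact ⟨_, _, hi, congrFun h3 i⟩
  · simp only [measure_iUnion_null_iff]
    exact fun i j hij => volume_setOf_apply_eq_apply hij

lemma volume_iUnion_sortedRegion {N : ℕ} {G : Set (Fin N → ℝ)} (hG : MeasurableSet G) :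
    volume (⋃ σ, sortedRegion G σ) = (N.factorial : ENNReal) * volume (solidSimplex N ∩ G) := by
  rw [measure_iUnion₀ (fun σ τ h => aedisjoint_sortedRegion G h)
    fun σ => (measurableSet_sortedRegion hG σ).nullMeasurableSet]
  simp [volume_sortedRegion hG, tsum_fintype, Fintype.card_perm]

/-- The sorted regions cover the unit cube, and each has the volume of the simplex. -/
lemma one_le_factorial_mul_volume_solidSimplex (N : ℕ) :
    1 ≤ (N.factorial : ENNReal) * volume (solidSimplex N) := by
  have h := volume_iUnion_sortedRegion (N := N) MeasurableSet.univ
  rw [Set.inter_univ] at h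
  rw [← h]
  calc (1 : ENNReal) = volume (Set.univ.pi fun _ : Fin N => Set.Icc (0 : ℝ) 1) := by
        rw [volume_pi_pi]
        simp
    _ ≤ _ := by
        refine measure_mono fun u hu => Set.mem_iUnion.2 ⟨Tuple.sort u, ?_, trivial⟩
        exact spacing_mem_solidSimplex_iff.2
          ⟨Tuple.monotone_sort u, fun i => hu _ trivial⟩

/-- The spacings of `N` independent uniform points of `(0, 1)` are uniform on the simplex. -/
theorem cond_solidSimplex_le {N : ℕ} {G : Set (Fin N → ℝ)} (hG : MeasurableSet G) :
    cond volume (solidSimplex N) G ≤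
      Measure.pi (fun _ : Fin N => (volume : Measure ℝ).restrict (Set.Ioo 0 1))
        (⋃ σ, sortedRegion G σ) := by
  have hae : (Set.univ.pi fun _ : Fin N => Set.Ioo (0 : ℝ) 1) =ᵐ[volume]
      (Set.univ.pi fun _ : Fin N => Set.Icc (0 : ℝ) 1) := by
    rw [Set.pi_univ_Icc]
    exact Measure.univ_pi_Ioo_ae_eq_Icc
  rw [← Measure.restrict_pi_pi, ← volume_pi, Measure.restrict_congr_set hae,
    Measure.restrict_eq_self _ (fun u hu => by
      obtain ⟨σ, hσ⟩ := Set.mem_iUnion.1 hu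
      intro i _
      simpa using (spacing_mem_solidSimplex_iff.1 hσ.1).2 (σ.symm i)),
    volume_iUnion_sortedRegion hG, cond_apply (measurableSet_solidSimplex N)]
  gcongr
  exact ENNReal.inv_le_iff_le_mul (by simp) (by simp [Nat.factorial_ne_zero]) |>.2
    (by simpa [mul_comm] using one_le_factorial_mul_volume_solidSimplex N)

end DivergenceCalibration

/-! ### Quantile coupling and the bound on the mean. -/

namespace DivergenceCalibration

open Filter Topology

open Classical in
/-- The quantile function of a distribution on the real line, set to `0` outside `(0, 1)`. -/
noncomputable def quantile (μ : Measure ℝ) (u : ℝ) : ℝ :=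
  if u ∈ Set.Ioo (0 : ℝ) 1 then sInf {x | u ≤ cdf μ x} else 0

/-- Right continuity of the cdf makes the infimum attained. -/
lemma quantile_le_iff (μ : Measure ℝ) {u : ℝ} (hu : u ∈ Set.Ioo (0 : ℝ) 1) (x : ℝ) :
    quantile μ u ≤ x ↔ u ≤ cdf μ x := by
  rw [quantile, if_pos hu]
  have hne : {x | u ≤ cdf μ x}.Nonempty := by
    obtain ⟨y, hy⟩ := ((tendsto_cdf_atTop μ).eventually (lt_mem_nhds hu.2)).exists
    exact ⟨y, hy.le⟩
  have hbdd : BddBelow {x | u ≤ cdf μ x} := by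
    obtain ⟨y, hy⟩ := ((tendsto_cdf_atBot μ).eventually (gt_mem_nhds hu.1)).exists
    refine ⟨y, fun w hw => ?_⟩
    by_contra! h
    exact absurd (hw.trans (monotone_cdf μ h.le)) (not_le.2 hy)
  refine ⟨fun h => ?_, fun h => csInf_le hbdd h⟩
  refine le_trans ?_ (monotone_cdf μ h)
  have hr : Tendsto (cdf μ) (𝓝[>] (sInf {x | u ≤ cdf μ x}))
      (𝓝 (cdf μ (sInf {x | u ≤ cdf μ x}))) :=
    ((cdf μ).right_continuous _).mono_left (nhdsWithin_mono _ Set.Ioi_subset_Ici_self)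
  refine ge_of_tendsto hr ?_
  filter_upwards [self_mem_nhdsWithin] with w hw
  obtain ⟨y, hy, hyw⟩ := exists_lt_of_csInf_lt hne hw
  exact le_trans hy (monotone_cdf μ hyw.le)

lemma monotoneOn_quantile (μ : Measure ℝ) : MonotoneOn (quantile μ) (Set.Ioo 0 1) :=
  fun _ hu _ hv huv =>
    (quantile_le_iff μ hu _).2 (huv.trans ((quantile_le_iff μ hv _).1 le_rfl))

lemma measurable_quantile (μ : Measure ℝ) : Measurable (quantile μ) := by
  refine measurable_of_Iic fun x => ?_
  have h : quantile μ ⁻¹' Set.Iic x =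
      (Set.Ioo 0 1 ∩ Set.Iic (cdf μ x)) ∪ ((Set.Ioo 0 1)ᶜ ∩ {_u | 0 ≤ x}) := by
    ext u
    by_cases hu : u ∈ Set.Ioo (0 : ℝ) 1
    · simp only [Set.mem_preimage, Set.mem_Iic, quantile_le_iff μ hu, Set.mem_union,
        Set.mem_inter_iff, Set.mem_compl_iff, hu, true_and, not_true_eq_false, false_and,
        or_false]
    · have : quantile μ u = 0 := if_neg hu
      simp only [Set.mem_preimage, Set.mem_Iic, this, Set.mem_union, Set.mem_inter_iff,
        Set.mem_compl_iff, hu, false_and, not_false_eq_true, true_and, false_or, Set.mem_ofPred_eq]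
  rw [h]
  exact (measurableSet_Ioo.inter measurableSet_Iic).union
    (measurableSet_Ioo.compl.inter (MeasurableSet.const _))

lemma measurePreserving_quantile (μ : Measure ℝ) [IsProbabilityMeasure μ] :
    MeasurePreserving (quantile μ) (volume.restrict (Set.Ioo 0 1)) μ := by
  refine ⟨measurable_quantile μ, ?_⟩
  refine (Measure.ext_of_Iic _ _ fun x => ?_).symm
  rw [Measure.map_apply (measurable_quantile μ) measurableSet_Iic,
    Measure.restrict_apply (measurable_quantile μ measurableSet_Iic), ← ofReal_cdf]
  have h : quantile μ ⁻¹' Set.Iic x ∩ Set.Ioo 0 1 = Set.Iic (cdf μ x) ∩ Set.Ioo 0 1 := by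
    ext u
    refine and_congr_left fun hu => quantile_le_iff μ hu x
  rw [h]
  refine le_antisymm ?_ ?_
  · calc ENNReal.ofReal (cdf μ x) = volume (Set.Ioo 0 (cdf μ x)) := by simp
      _ ≤ volume (Set.Iic (cdf μ x) ∩ Set.Ioo 0 1) := measure_mono fun u hu =>
        ⟨hu.2.le, hu.1, hu.2.trans_le (cdf_le_one μ x)⟩
  · calc _ ≤ volume (Set.Ioc 0 (cdf μ x)) := measure_mono fun u hu => ⟨hu.2.1, hu.1⟩
      _ = _ := by simp

/-- On each cell of the grid `v` a monotone `q` is at most its value at the right endpoint; the last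
cell has no sample on its right and is bounded by `M`. -/
lemma integral_le_sum_spacing {N : ℕ} {q : ℝ → ℝ} {M : ℝ} (hq : IntervalIntegrable q volume 0 1)
    (hmono : MonotoneOn q (Set.Ioo 0 1)) (hM : ∀ u ∈ Set.Ioo (0 : ℝ) 1, q u ≤ M)
    {v : Fin N → ℝ} (hv : Monotone v) (hv01 : ∀ i, v i ∈ Set.Ioo (0 : ℝ) 1) :
    ∫ t in (0 : ℝ)..1, q t ≤
      ∑ i, spacing N v i * q (v i) + (1 - ∑ i, spacing N v i) * M := by
  set e : Fin (N + 1) → ℝ := Fin.cons (α := fun _ => ℝ) 0 v with he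
  have hs : ∀ i, spacing N v i = e i.succ - e i.castSucc := fun i => rfl
  have hΔ := spacing_mem_solidSimplex_iff.2 ⟨hv, fun i => Set.Ioo_subset_Icc_self (hv01 i)⟩
  have hsum : ∑ i, spacing N v i = e (Fin.last N) := by
    simp only [hs, sum_succ_sub_castSucc]
    simp [he]
  have he01 : ∀ j, e j ∈ Set.Icc (0 : ℝ) 1 := fun j => by
    cases j using Fin.cases with
    | zero => simp [he]
    | succ i => exact Set.Ioo_subset_Icc_self (hv01 i)
  have hint : ∀ a ∈ Set.Icc (0 : ℝ) 1, ∀ b ∈ Set.Icc (0 : ℝ) 1, IntervalIntegrable q volume a b :=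
    fun a ha b hb => hq.mono_set (by
      rw [Set.uIcc_of_le zero_le_one]
      exact Set.uIcc_subset_Icc ha hb)
  have h0 : (0 : ℝ) ∈ Set.Icc (0 : ℝ) 1 := ⟨le_rfl, zero_le_one⟩
  have h1 : (1 : ℝ) ∈ Set.Icc (0 : ℝ) 1 := ⟨zero_le_one, le_rfl⟩
  have hbound : ∀ a ∈ Set.Icc (0 : ℝ) 1, ∀ b ∈ Set.Icc (0 : ℝ) 1, a ≤ b → ∀ C : ℝ,
      (∀ t ∈ Set.Ioo a b, q t ≤ C) → ∫ t in a..b, q t ≤ (b - a) * C := by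
    intro a ha b hb hab C hC
    have := intervalIntegral.integral_mono_on_of_le_Ioo hab (hint a ha b hb)
      (intervalIntegrable_const (c := C)) hC
    simpa using this
  have hpiece : ∀ i, (∫ t in (0 : ℝ)..e i.succ, q t) - (∫ t in (0 : ℝ)..e i.castSucc, q t)
      ≤ spacing N v i * q (v i) := by
    intro i
    rw [intervalIntegral.integral_interval_sub_left (hint _ h0 _ (he01 _)) (hint _ h0 _ (he01 _)),
      hs]
    refine hbound _ (he01 _) _ (he01 _) (by linarith [hΔ.1 i, hs i]) _ fun t ht => ?_
    have ht2 : t < v i := ht.2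
    exact hmono ⟨(he01 _).1.trans_lt ht.1, ht2.trans (hv01 i).2⟩ (hv01 i) ht2.le
  have htel := sum_succ_sub_castSucc fun j => ∫ t in (0 : ℝ)..e j, q t
  have hpieces := Finset.sum_le_sum fun i (_ : i ∈ Finset.univ) => hpiece i
  rw [htel] at hpieces
  have he0 : ∫ t in (0 : ℝ)..e 0, q t = 0 := intervalIntegral.integral_same
  have hlast := hbound _ (he01 (Fin.last N)) 1 h1 (he01 _).2 M fun t ht =>
    hM t ⟨(he01 _).1.trans_lt ht.1, ht.2⟩
  have hadd := intervalIntegral.integral_add_adjacent_intervals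
    (hint _ h0 _ (he01 (Fin.last N))) (hint _ (he01 (Fin.last N)) _ h1)
  rw [hsum]
  linarith

lemma measurable_supportValue {n : ℕ} (A : Set (Fin n → ℝ)) : Measurable (supportValue A) := by
  refine LowerSemicontinuous.measurable ?_
  refine lowerSemicontinuous_biSup fun μ _ => Continuous.lowerSemicontinuous ?_
  exact continuous_coe_real_ereal.comp (by fun_prop)

/-- The extension of a permutation that fixes the last element. -/
def extendPerm {N : ℕ} (σ : Equiv.Perm (Fin N)) : Equiv.Perm (Fin (N + 1)) :=
  finSuccEquivLast.trans ((Equiv.optionCongr σ).trans finSuccEquivLast.symm)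

@[simp] lemma extendPerm_castSucc {N : ℕ} (σ : Equiv.Perm (Fin N)) (i : Fin N) :
    extendPerm σ i.castSucc = (σ i).castSucc := by
  simp [extendPerm]

@[simp] lemma extendPerm_last {N : ℕ} (σ : Equiv.Perm (Fin N)) :
    extendPerm σ (Fin.last N) = Fin.last N := by
  simp [extendPerm]

section Admissible

variable {Ω : Type*} [MeasurableSpace Ω] {P : Measure Ω} [IsProbabilityMeasure P] {Z : Ω → ℝ}

lemma IsAdmissible.quantile_le_essSup (hZ : IsAdmissible P Z) {u : ℝ}
    (hu : u ∈ Set.Ioo (0 : ℝ) 1) : quantile (P.map Z) u ≤ essSup Z P := by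
  have := Measure.isProbabilityMeasure_map hZ.measurable.aemeasurable (μ := P)
  rw [quantile_le_iff _ hu]
  obtain ⟨b, hb⟩ := hZ.bddAbove
  have h1 : ∀ᵐ ω ∂P, Z ω ≤ essSup Z P :=
    ae_le_essSup (isBoundedUnder_of_eventually_le hb)
  have h2 : cdf (P.map Z) (essSup Z P) = 1 := by
    rw [cdf_eq_real, map_measureReal_apply hZ.measurable measurableSet_Iic, measureReal_def,
      prob_compl_eq_zero_iff (hZ.measurable measurableSet_Iic) |>.1 h1]
    simp
  rw [h2]
  exact hu.2.le

lemma IsAdmissible.intervalIntegrable_quantile (hZ : IsAdmissible P Z) :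
    IntervalIntegrable (quantile (P.map Z)) volume 0 1 := by
  have := Measure.isProbabilityMeasure_map hZ.measurable.aemeasurable (μ := P)
  rw [intervalIntegrable_iff_integrableOn_Ioo_of_le zero_le_one]
  have h1 : Integrable id (P.map Z) :=
    (integrable_map_measure (by fun_prop) hZ.measurable.aemeasurable).2 hZ.integrable
  exact (measurePreserving_quantile (P.map Z)).integrable_comp_of_integrable h1

lemma IsAdmissible.integral_quantile (hZ : IsAdmissible P Z) :
    ∫ t in (0 : ℝ)..1, quantile (P.map Z) t = ∫ ω, Z ω ∂P := by
  have := Measure.isProbabilityMeasure_map hZ.measurable.aemeasurable (μ := P)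
  rw [intervalIntegral.integral_of_le zero_le_one, integral_Ioc_eq_integral_Ioo]
  have h1 := integral_map (φ := Z) hZ.measurable.aemeasurable (f := id) (μ := P) (by fun_prop)
  have h2 := integral_map (μ := volume.restrict (Set.Ioo 0 1))
    (measurable_quantile (P.map Z)).aemeasurable (f := id) (by fun_prop)
  rw [(measurePreserving_quantile (P.map Z)).map_eq] at h2
  simp only [id] at h1 h2
  rw [← h2, h1]

/-- The upper Riemann sum has the spacings as weights and increasing data, because the essential
supremum in the last place dominates all quantiles; hence the duality bound applies. -/
lemma IsAdmissible.integral_le_supportValue {N : ℕ} {φ : ℝ → EReal}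
    (hφ : IsDivergenceGenerator φ) (hZ : IsAdmissible P Z) {α : ℝ} {u : Fin N → ℝ}
    (hu : ∀ i, u i ∈ Set.Ioo (0 : ℝ) 1) (σ : Equiv.Perm (Fin N)) (hσ : Monotone (u ∘ σ))
    (h : monotoneDivergence φ (Fin.snoc (α := fun _ => ℝ) (spacing N (u ∘ σ))
      (1 - ∑ i, spacing N (u ∘ σ) i)) ≤ α) :
    ((∫ ω, Z ω ∂P : ℝ) : EReal) ≤ supportValue (ambiguitySet (N + 1) φ α)
      (Fin.snoc (α := fun _ => ℝ) (fun i => quantile (P.map Z) (u i)) (essSup Z P)) := by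
  have hν : ∑ i, Fin.snoc (α := fun _ => ℝ) (spacing N (u ∘ σ))
      (1 - ∑ i, spacing N (u ∘ σ) i) i = 1 := by
    rw [Fin.sum_univ_castSucc]
    simp
  refine le_trans ?_ (hφ.le_supportValue N.succ_ne_zero hν h _ (extendPerm σ) ?_)
  · rw [EReal.coe_le_coe_iff, ← hZ.integral_quantile, Fin.sum_univ_castSucc]
    simp only [Fin.snoc_castSucc, Fin.snoc_last, extendPerm_castSucc, extendPerm_last]
    exact integral_le_sum_spacing hZ.intervalIntegrable_quantile (monotoneOn_quantile _)
      (fun _ => hZ.quantile_le_essSup) hσ fun i => hu _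
  · intro i j hij
    induction j using Fin.lastCases with
    | last =>
      induction i using Fin.lastCases with
      | last => exact le_rfl
      | cast i => simpa using hZ.quantile_le_essSup (hu (σ i))
    | cast j =>
      induction i using Fin.lastCases with
      | last => exact absurd hij (not_le.2 (Fin.castSucc_lt_last j))
      | cast i => simpa using monotoneOn_quantile _ (hu _) (hu _) (hσ (by simpa using hij))

/-- A radius that exceeds the sampled radius with probability at least `1 - δ` is calibrated. -/
theorem IsAdmissible.isCalibrated {N : ℕ} {φ : ℝ → EReal} (hφ : IsDivergenceGenerator φ)
    (hZ : IsAdmissible P Z) {α δ : ℝ}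
    (hmeas : NullMeasurableSet {ν | monotoneDivergence φ ν ≤ α} (uniformSimplex N))
    (h : ENNReal.ofReal (1 - δ) ≤ uniformSimplex N {ν | monotoneDivergence φ ν ≤ α}) :
    IsCalibrated (ambiguitySet (N + 1) φ α) δ P Z := by
  have := Measure.isProbabilityMeasure_map hZ.measurable.aemeasurable (μ := P)
  -- The sublevel set is only null measurable; a measurable subset of full measure in it can be
  -- pulled back through the chart.
  obtain ⟨S, hS, hSm, hSe⟩ := hmeas.exists_measurable_subset_ae_eq
  rw [← measure_congr hSe] at h
  refine h.trans ?_
  have hT : Measurable fun x : Fin N → ℝ => Fin.snoc (α := fun _ => ℝ) x (1 - ∑ i, x i) :=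
    (Continuous.finSnoc continuous_id (by fun_prop)).measurable
  have hB : MeasurableSet {x : Fin N → ℝ | ((∫ ω, Z ω ∂P : ℝ) : EReal) ≤
      supportValue (ambiguitySet (N + 1) φ α)
        (Fin.snoc (α := fun _ => ℝ) x (essSup Z P))} :=
    measurableSet_le measurable_const ((measurable_supportValue _).comp
      (Continuous.finSnoc continuous_id continuous_const).measurable)
  have hPZ : MeasurePreserving (fun (ω : Fin N → Ω) i => Z (ω i)) (Measure.pi fun _ => P)
      (Measure.pi fun _ => P.map Z) :=
    measurePreserving_pi _ _ fun _ => ⟨hZ.measurable, rfl⟩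
  have hq : MeasurePreserving (fun (u : Fin N → ℝ) i => quantile (P.map Z) (u i))
      (Measure.pi fun _ => volume.restrict (Set.Ioo 0 1)) (Measure.pi fun _ => P.map Z) :=
    measurePreserving_pi _ _ fun _ => measurePreserving_quantile _
  have h1 := hPZ.measure_preimage hB.nullMeasurableSet
  have h2 := hq.measure_preimage hB.nullMeasurableSet
  refine le_trans ?_ (h2.trans h1.symm).le
  have h3 : uniformSimplex N S = cond volume (solidSimplex N)
      ((fun x : Fin N → ℝ => Fin.snoc (α := fun _ => ℝ) x (1 - ∑ i, x i)) ⁻¹' S) :=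
    Measure.map_apply hT hSm
  rw [h3]
  refine (cond_solidSimplex_le (hT hSm)).trans (measure_mono_ae ?_)
  have hae : ∀ᵐ u ∂(Measure.pi fun _ : Fin N => (volume : Measure ℝ).restrict (Set.Ioo 0 1)),
      u ∈ Set.univ.pi fun _ : Fin N => Set.Ioo (0 : ℝ) 1 := by
    rw [← Measure.restrict_pi_pi]
    exact ae_restrict_mem (MeasurableSet.univ_pi fun _ => measurableSet_Ioo)
  filter_upwards [hae] with u hu hmem
  obtain ⟨σ, hσ⟩ := Set.mem_iUnion.1 hmem
  exact hZ.integral_le_supportValue hφ (fun i => hu i trivial) σ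
    (spacing_mem_solidSimplex_iff.1 hσ.1).1 (hS hσ.2)

end Admissible

end DivergenceCalibration

/-! ### Binomial tails, the incomplete beta function and order statistics. -/

namespace DivergenceCalibration

open Polynomial

/-- The probability that a binomial variable with parameters `m` and `p` is at least `k`. -/
noncomputable def binomialTail (m k : ℕ) (p : ℝ) : ℝ :=
  ∑ j ∈ Finset.range (m + 1), if k ≤ j then (m.choose j : ℝ) * p ^ j * (1 - p) ^ (m - j) else 0

lemma binomialTail_eq_eval (k d : ℕ) (p : ℝ) :
    binomialTail (k + d) k p =
      (∑ i ∈ Finset.range (d + 1), bernsteinPolynomial ℝ (k + d) (k + i)).eval p := by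
  rw [binomialTail, add_assoc, Finset.sum_range_add,
    Finset.sum_eq_zero (fun j hj => if_neg (not_le.2 (Finset.mem_range.1 hj))), zero_add,
    eval_finsetSum]
  refine Finset.sum_congr rfl fun i _ => ?_
  rw [if_pos (Nat.le_add_right k i)]
  simp [bernsteinPolynomial]

/-- Each derivative is a difference of consecutive Bernstein polynomials, so the sum telescopes; the
upper end has index above the degree and vanishes. -/
lemma derivative_sum_bernsteinPolynomial (k d : ℕ) :
    derivative (∑ i ∈ Finset.range (d + 1), bernsteinPolynomial ℝ (k + 1 + d) (k + 1 + i)) =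
      ((k + 1 + d : ℕ) : ℝ[X]) * bernsteinPolynomial ℝ (k + d) k := by
  rw [derivative_sum]
  have h : ∀ i, derivative (bernsteinPolynomial ℝ (k + 1 + d) (k + 1 + i)) =
      ((k + 1 + d : ℕ) : ℝ[X]) * (bernsteinPolynomial ℝ (k + d) (k + i) -
        bernsteinPolynomial ℝ (k + d) (k + (i + 1))) := fun i => by
    have := bernsteinPolynomial.derivative_succ ℝ (k + 1 + d) (k + i)
    rw [show k + 1 + d - 1 = k + d by omega] at this
    rw [show k + 1 + i = k + i + 1 by omega, this]
    rfl
  simp only [h]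
  rw [← Finset.mul_sum, Finset.sum_range_sub',
    bernsteinPolynomial.eq_zero_of_lt ℝ (by omega : k + d < k + (d + 1)), sub_zero, add_zero]

lemma binomialTail_eq_integral (k d : ℕ) (p : ℝ) :
    binomialTail (k + 1 + d) (k + 1) p =
      ((k + 1 + d : ℕ) * (k + d).choose k : ℝ) * ∫ t in (0 : ℝ)..p, t ^ k * (1 - t) ^ d := by
  set T := ∑ i ∈ Finset.range (d + 1), bernsteinPolynomial ℝ (k + 1 + d) (k + 1 + i) with hT
  have hd : ∀ t, HasDerivAt (fun x => T.eval x)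
      (((k + 1 + d : ℕ) * (k + d).choose k : ℝ) * (t ^ k * (1 - t) ^ d)) t := fun t => by
    have h := T.hasDerivAt t
    rw [hT, derivative_sum_bernsteinPolynomial, ← hT] at h
    have h2 : eval t (((k + 1 + d : ℕ) : ℝ[X]) * bernsteinPolynomial ℝ (k + d) k) =
        ((k + 1 + d : ℕ) * (k + d).choose k : ℝ) * (t ^ k * (1 - t) ^ d) := by
      simp [bernsteinPolynomial]
      ring
    rwa [h2] at h
  have h0 : T.eval 0 = 0 := by
    rw [hT, eval_finsetSum]
    refine Finset.sum_eq_zero fun i _ => ?_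
    rw [bernsteinPolynomial.eval_at_0, if_neg (by omega)]
  have := intervalIntegral.integral_eq_sub_of_hasDerivAt (a := 0) (b := p)
    (fun t _ => hd t) (Continuous.intervalIntegrable (by fun_prop) _ _)
  rw [intervalIntegral.integral_const_mul, h0, sub_zero] at this
  rw [binomialTail_eq_eval, this]

lemma binomialTail_one {m k : ℕ} (hkm : k ≤ m) : binomialTail m k 1 = 1 := by
  rw [binomialTail, Finset.sum_eq_single m]
  · simp [hkm]
  · intro j hj hjm
    have : m - j ≠ 0 := by
      have := Finset.mem_range.1 hj
      omega
    simp [this]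
  · simp

lemma cdf_betaMeasure_eq_integral (k d : ℕ) {p : ℝ} (hp : p ∈ Set.Icc (0 : ℝ) 1) :
    cdf (betaMeasure ((k : ℝ) + 1) ((d : ℝ) + 1)) p =
      1 / beta ((k : ℝ) + 1) ((d : ℝ) + 1) * ∫ t in (0 : ℝ)..p, t ^ k * (1 - t) ^ d := by
  have := isProbabilityMeasureBeta (α := (k : ℝ) + 1) (β := (d : ℝ) + 1)
    (by positivity) (by positivity)
  have hnn : ∀ x, 0 ≤ betaPDFReal ((k : ℝ) + 1) ((d : ℝ) + 1) x := fun x => by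
    by_cases hx : 0 < x ∧ x < 1
    · exact (betaPDFReal_pos hx.1 hx.2 (by positivity) (by positivity)).le
    · rw [betaPDFReal, if_neg hx]
  rw [cdf_eq_real, measureReal_def, betaMeasure, withDensity_apply _ measurableSet_Iic]
  have h1 : (∫⁻ x in Set.Iic p, betaPDF ((k : ℝ) + 1) ((d : ℝ) + 1) x).toReal =
      ∫ x in Set.Iic p, betaPDFReal ((k : ℝ) + 1) ((d : ℝ) + 1) x :=
    (integral_eq_lintegral_of_nonneg_ae (Filter.Eventually.of_forall hnn)
      (by fun_prop)).symm
  rw [h1, ← intervalIntegral.integral_const_mul, intervalIntegral.integral_of_le hp.1,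
    integral_Ioc_eq_integral_Ioo]
  have h2 : ∫ x in Set.Iic p, betaPDFReal ((k : ℝ) + 1) ((d : ℝ) + 1) x =
      ∫ x in Set.Iio p, betaPDFReal ((k : ℝ) + 1) ((d : ℝ) + 1) x :=
    integral_Iic_eq_integral_Iio
  rw [h2]
  have h3 : ∫ x in Set.Ioo 0 p, betaPDFReal ((k : ℝ) + 1) ((d : ℝ) + 1) x =
      ∫ x in Set.Iio p, betaPDFReal ((k : ℝ) + 1) ((d : ℝ) + 1) x := by
    refine (setIntegral_eq_of_subset_of_forall_sdiff_eq_zero measurableSet_Iio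
      (fun x hx => hx.2) fun x hx => ?_).symm
    rw [betaPDFReal, if_neg]
    exact fun h => hx.2 ⟨h.1, hx.1⟩
  rw [← h3]
  refine setIntegral_congr_fun measurableSet_Ioo fun x hx => ?_
  have hx1 : x < 1 := hx.2.trans_le hp.2
  simp only [betaPDFReal, hx.1, hx1, and_self, if_true, add_sub_cancel_right, Real.rpow_natCast]
  ring

lemma cdf_betaMeasure_one {a b : ℝ} (ha : 0 < a) (hb : 0 < b) : cdf (betaMeasure a b) 1 = 1 := by
  have := isProbabilityMeasureBeta ha hb
  have h : betaMeasure a b (Set.Iic 1)ᶜ = 0 := by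
    rw [betaMeasure, withDensity_apply _ measurableSet_Iic.compl]
    refine setLIntegral_eq_zero measurableSet_Iic.compl fun x hx => ?_
    exact betaPDF_eq_zero_of_one_le (lt_of_not_ge fun h => hx h).le
  rw [cdf_eq_real, measureReal_def, (prob_compl_eq_zero_iff measurableSet_Iic).1 h,
    ENNReal.toReal_one]

/-- Binomial tail probabilities are values of the regularized incomplete beta function. -/
theorem binomialTail_eq_regularizedIncompleteBeta {m k : ℕ} (hk : 1 ≤ k) (hkm : k ≤ m) {p : ℝ}
    (hp : p ∈ Set.Icc (0 : ℝ) 1) :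
    binomialTail m k p = regularizedIncompleteBeta p k (m - k + 1) := by
  obtain ⟨k, rfl⟩ := Nat.exists_eq_add_of_le' hk
  obtain ⟨d, rfl⟩ := Nat.exists_eq_add_of_le hkm
  have hcast : (((k + 1 + d : ℕ) : ℝ) - ((k + 1 : ℕ) : ℝ) + 1) = (d : ℝ) + 1 := by
    push_cast
    ring
  rw [regularizedIncompleteBeta, hcast, Nat.cast_add_one, cdf_betaMeasure_eq_integral k d hp,
    binomialTail_eq_integral]
  have h1 := binomialTail_one hkm
  have h2 := cdf_betaMeasure_one (a := (k : ℝ) + 1) (b := (d : ℝ) + 1)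
    (by positivity) (by positivity)
  rw [binomialTail_eq_integral] at h1
  rw [cdf_betaMeasure_eq_integral k d ⟨zero_le_one, le_rfl⟩] at h2
  -- Both sides are constants times the same integral and both equal `1` at `p = 1`, so the
  -- constants agree without evaluating the beta function.
  have h3 := mul_right_cancel₀ (right_ne_zero_of_mul_eq_one h1) (h2.trans h1.symm)
  rw [h3]

lemma binomialTail_mono {m k : ℕ} (hk : 1 ≤ k) (hkm : k ≤ m) {p p' : ℝ} (hp : 0 ≤ p)
    (hpp' : p ≤ p') (hp' : p' ≤ 1) : binomialTail m k p ≤ binomialTail m k p' := by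
  rw [binomialTail_eq_regularizedIncompleteBeta hk hkm ⟨hp, hpp'.trans hp'⟩,
    binomialTail_eq_regularizedIncompleteBeta hk hkm ⟨hp.trans hpp', hp'⟩]
  exact monotone_cdf _ hpp'

open Classical in
-- Union bound over the exact set `S` of successful indices, each pattern having a product
-- probability.
lemma measureReal_le_card_le_binomialTail {Ω β : Type*} [MeasurableSpace Ω] [MeasurableSpace β]
    {Q : Measure Ω} [IsProbabilityMeasure Q] {m : ℕ} {a : Fin m → Ω → β} (ha : iIndepFun a Q)
    (hmeas : ∀ j, AEMeasurable (a j) Q) {B : Set β} (hB : MeasurableSet B) {p : ℝ}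
    (hp : ∀ j, Q.real (a j ⁻¹' B) = p) (k : ℕ) :
    Q.real {ω | k ≤ (Finset.univ.filter fun j => a j ω ∈ B).card} ≤ binomialTail m k p := by
  have hpc : ∀ j, Q.real (a j ⁻¹' Bᶜ) = 1 - p := fun j => by
    rw [Set.preimage_compl, probReal_compl_eq_one_sub₀ ((hmeas j).nullMeasurable hB), hp]
  have hS : ∀ S : Finset (Fin m), Q.real (⋂ j ∈ Finset.univ, a j ⁻¹' (if j ∈ S then B else Bᶜ)) =
      p ^ S.card * (1 - p) ^ (m - S.card) := fun S => by
    rw [measureReal_def, ha.measure_inter_preimage_eq_mul Finset.univ (fun j _ => by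
      split_ifs
      exacts [hB, hB.compl]), ENNReal.toReal_prod]
    have h1 : ∀ j, (Q (a j ⁻¹' (if j ∈ S then B else Bᶜ))).toReal = if j ∈ S then p else 1 - p :=
      fun j => by
        split_ifs
        exacts [hp j, hpc j]
    simp only [h1]
    rw [Finset.prod_ite, Finset.prod_const, Finset.prod_const]
    congr 2
    · simp
    · rw [Finset.filter_not, Finset.card_sdiff_of_subset (Finset.filter_subset _ _)]
      simp
  calc Q.real {ω | k ≤ (Finset.univ.filter fun j => a j ω ∈ B).card}
      ≤ Q.real (⋃ S ∈ (Finset.univ : Finset (Fin m)).powerset.filter (fun S => k ≤ S.card),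
          ⋂ j ∈ Finset.univ, a j ⁻¹' (if j ∈ S then B else Bᶜ)) := by
        refine measureReal_mono (fun ω hω => ?_) (measure_ne_top _ _)
        simp only [Set.mem_iUnion]
        refine ⟨Finset.univ.filter fun j => a j ω ∈ B, by simpa using hω, ?_⟩
        simp only [Set.mem_iInter]
        intro j _
        by_cases hj : a j ω ∈ B <;> simp [hj]
    _ ≤ ∑ S ∈ (Finset.univ : Finset (Fin m)).powerset.filter (fun S => k ≤ S.card),
          p ^ S.card * (1 - p) ^ (m - S.card) := by
        refine (measureReal_biUnion_finset_le _ _).trans_eq ?_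
        simp only [hS]
    _ = binomialTail m k p := by
        rw [Finset.sum_filter, binomialTail]
        have := Finset.sum_powerset_apply_card (x := (Finset.univ : Finset (Fin m)))
          (fun j => if k ≤ j then p ^ j * (1 - p) ^ (m - j) else 0)
        rw [this, Finset.card_univ, Fintype.card_fin]
        refine Finset.sum_congr rfl fun j _ => ?_
        split_ifs <;> simp [mul_assoc]

lemma le_card_of_orderStatistic_mem_Iio {m : ℕ} (a : Fin m → EReal) {k : ℕ} (hk : 1 ≤ k)
    (hkm : k - 1 < m) {q : EReal} (h : orderStatistic a ⟨k - 1, hkm⟩ < q)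
    [DecidablePred fun j => a j ∈ Set.Iio q] :
    k ≤ (Finset.univ.filter fun j => a j ∈ Set.Iio q).card := by
  have hc : (Finset.Iic (⟨k - 1, hkm⟩ : Fin m)).card = k := by
    rw [Fin.card_Iic]
    change k - 1 + 1 = k
    omega
  rw [← hc]
  refine Finset.card_le_card_of_injOn (Tuple.sort a) (fun j hj => ?_)
    (Tuple.sort a).injective.injOn
  have hj' := Finset.mem_Iic.1 (Finset.mem_coe.1 hj)
  simpa using (Tuple.monotone_sort a hj').trans_lt h

/-! ### From the law of the sampled radius to the confidence bound. -/

section Radius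

variable {N : ℕ} {φ : ℝ → EReal} {δ : ℝ}

/-- The threshold `q` may be infinite, and calibration is tested at real radii; the strict sublevel
set is an increasing countable union over rationals below `q`. -/
lemma uniformSimplex_lt_le {q : EReal}
    (hq : ∀ α : ℝ, (α : EReal) < q →
      uniformSimplex N {ν | monotoneDivergence φ ν ≤ α} ≤ ENNReal.ofReal (1 - δ)) :
    uniformSimplex N (monotoneDivergence φ ⁻¹' Set.Iio q) ≤ ENNReal.ofReal (1 - δ) := by
  have h : monotoneDivergence (n := N + 1) φ ⁻¹' Set.Iio q =
      ⋃ r : {r : ℚ // ((r : ℝ) : EReal) < q}, {ν | monotoneDivergence φ ν ≤ ((r : ℝ) : EReal)} := by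
    ext ν
    simp only [Set.mem_preimage, Set.mem_Iio, Set.mem_iUnion]
    constructor
    · intro hν
      obtain ⟨r, h1, h2⟩ := EReal.lt_iff_exists_rat_btwn.1 hν
      exact ⟨⟨r, h2⟩, h1.le⟩
    · rintro ⟨r, hr⟩
      exact lt_of_le_of_lt hr r.2
  rw [h, Directed.measure_iUnion]
  · exact iSup_le fun r => hq _ r.2
  · refine Monotone.directed_le fun r s hrs ν hν => ?_
    exact le_trans hν (EReal.coe_le_coe_iff.2 (by exact_mod_cast hrs))

variable {Ω : Type*} [MeasurableSpace Ω] {Q : Measure Ω} {m : ℕ} {a : Fin m → Ω → EReal}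

lemma nullMeasurableSet_monotoneDivergence_le
    (ha_law : ∀ j, IdentDistrib (a j) (monotoneDivergence (n := N + 1) φ) Q (uniformSimplex N))
    (j : Fin m) (α : ℝ) :
    NullMeasurableSet {ν | monotoneDivergence φ ν ≤ α} (uniformSimplex N) :=
  (ha_law j).aemeasurable_snd.nullMeasurable measurableSet_Iic

lemma one_sub_regularizedIncompleteBeta_le [IsProbabilityMeasure Q]
    (hδ : δ ∈ Set.Icc (0 : ℝ) 1) (ha_indep : iIndepFun a Q)
    (ha_law : ∀ j, IdentDistrib (a j) (monotoneDivergence (n := N + 1) φ) Q (uniformSimplex N))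
    {k : ℕ} (hk : 1 ≤ k) (hkm : k ≤ m) (hkm' : k - 1 < m) {q : EReal}
    (hq : ∀ α : ℝ, (α : EReal) < q →
      uniformSimplex N {ν | monotoneDivergence φ ν ≤ α} ≤ ENNReal.ofReal (1 - δ)) :
    1 - regularizedIncompleteBeta (1 - δ) k (m - k + 1) ≤
      Q.real {ω | q ≤ orderStatistic (fun j => a j ω) ⟨k - 1, hkm'⟩} := by
  classical
  have hδ' : (0 : ℝ) ≤ 1 - δ := by linarith [hδ.2]
  set p : ℝ := (uniformSimplex N (monotoneDivergence φ ⁻¹' Set.Iio q)).toReal with hp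
  have hp1 : p ≤ 1 - δ := ENNReal.toReal_le_of_le_ofReal hδ' (uniformSimplex_lt_le hq)
  have hpj : ∀ j, Q.real (a j ⁻¹' Set.Iio q) = p := fun j => by
    rw [measureReal_def, (ha_law j).measure_mem_eq measurableSet_Iio]
  have h1 := measureReal_le_card_le_binomialTail ha_indep
    (fun j => (ha_law j).aemeasurable_fst) measurableSet_Iio hpj k
  have h2 := binomialTail_mono hk hkm ENNReal.toReal_nonneg hp1 (by linarith [hδ.1])
  rw [binomialTail_eq_regularizedIncompleteBeta hk hkm ⟨hδ', by linarith [hδ.1]⟩] at h2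
  set S := {ω | q ≤ orderStatistic (fun j => a j ω) ⟨k - 1, hkm'⟩}
  have h3 : Q.real Sᶜ ≤
      Q.real {ω | k ≤ (Finset.univ.filter fun j => a j ω ∈ Set.Iio q).card} := by
    refine measureReal_mono fun ω hω => ?_
    exact le_card_of_orderStatistic_mem_Iio _ hk hkm' (not_le.1 hω)
  -- Subadditivity suffices here, so `S` need not be measurable.
  have h4 : 1 ≤ Q.real S + Q.real Sᶜ := by
    have := measureReal_union_le (μ := Q) S Sᶜ
    rwa [Set.union_compl_self, probReal_univ] at this
  have h5 : Q.real {ω | k ≤ (Finset.univ.filter fun j => a j ω ∈ Set.Iio q).card} ≤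
      binomialTail m k p := by
    convert h1
  linarith

end Radius

end DivergenceCalibration

theorem mainTheorem5
    (N : ℕ) (φ : ℝ → EReal) (hφ : DivergenceCalibration.IsDivergenceGenerator φ)
    (δ : ℝ) (hδ : δ ∈ Set.Icc (0 : ℝ) 1)
    {Ω : Type*} [MeasurableSpace Ω] (Q : Measure Ω) [IsProbabilityMeasure Q]
    (m : ℕ) (a : Fin m → Ω → EReal)
    (ha_indep : iIndepFun a Q)
    (ha_law : ∀ j, IdentDistrib (a j)
      (DivergenceCalibration.monotoneDivergence (n := N + 1) φ)
      Q (DivergenceCalibration.uniformSimplex N))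
    {Θ Ξ : Type*} [MeasurableSpace Ξ] (P : Measure Ξ) [IsProbabilityMeasure P]
    (l : Θ → Ξ → ℝ) (hl : ∀ θ, DivergenceCalibration.IsAdmissible P (l θ))
    (k : ℕ) (hk : 1 ≤ k) (hkm : k ≤ m) :
    (1 - DivergenceCalibration.regularizedIncompleteBeta (1 - δ) k (m - k + 1) ≤
      Q.real {ω | DivergenceCalibration.calibrationRadius N φ δ P l ≤
        DivergenceCalibration.orderStatistic (fun j => a j ω) ⟨k - 1, by omega⟩}) ∧
    (1 - DivergenceCalibration.regularizedIncompleteBeta (1 - δ) k (m - k + 1) ≤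
      Q.real {ω | DivergenceCalibration.scalarCalibrationRadius N φ δ ≤
        DivergenceCalibration.orderStatistic (fun j => a j ω) ⟨k - 1, by omega⟩}) := by
  -- Measurability of the sublevel sets comes from the law of one sample, which exists since `1 ≤ k
  -- ≤ m`.
  have hmeas := DivergenceCalibration.nullMeasurableSet_monotoneDivergence_le ha_law
    ⟨0, hk.trans hkm⟩
  constructor
  · refine DivergenceCalibration.one_sub_regularizedIncompleteBeta_le hδ ha_indep ha_law hk hkm
      _ fun α hα => ?_
    -- A real `α` below the infimum with probability above `1 - δ` would be calibrated, hence at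
    -- least the infimum.
    by_contra! h
    exact hα.not_ge (iInf₂_le (f := fun (α : ℝ) (_ : ∀ θ, DivergenceCalibration.IsCalibrated
      (DivergenceCalibration.ambiguitySet (N + 1) φ α) δ P (l θ)) => (α : EReal)) α
      fun θ => (hl θ).isCalibrated hφ (hmeas α) h.le)
  · refine DivergenceCalibration.one_sub_regularizedIncompleteBeta_le hδ ha_indep ha_law hk hkm
      _ fun α hα => ?_
    by_contra! h
    exact hα.not_ge (iInf₂_le (f := fun (α : ℝ) (_ : ∀ (Ω : Type) [MeasurableSpace Ω]
      (P : Measure Ω) [IsProbabilityMeasure P] (Z : Ω → ℝ),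
      DivergenceCalibration.IsAdmissible P Z → DivergenceCalibration.IsCalibrated
        (DivergenceCalibration.ambiguitySet (N + 1) φ α) δ P Z) => (α : EReal)) α
      fun _ _ _ _ _ hZ => hZ.isCalibrated hφ (hmeas α) h.le)
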